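/- For $n \ge 3$ let $SG_n$ be the singular braid group on $n$ strands, that is, the group with generators $\sigma_1,\dots,\sigma_{n-1},\rho_1,\dots,\rho_{n-1}$ and defining relations $$\sigma_i\sigma_j=\sigma_j\sigma_i \quad\text{and}\quad \rho_i\rho_j=\rho_j\rho_i \quad (|i-j|>1),$$ $$\sigma_i\sigma_{i+1}\sigma_i=\sigma_{i+1}\sigma_i\sigma_{i+1},\qquad \rho_i\sigma_{i+1}\sigma_i=\sigma_{i+1}\sigma_i\rho_{i+1},\qquad \rho_{i+1}\sigma_i\sigma_{i+1}=\sigma_i\sigma_{i+1}\rho_i \quad (1\le i\le n-2),$$ $$\sigma_i\rho_j=\rho_j\sigma_i \quad (i=j \text{ or } |i-j|>1).$$ Let $SG_n'$ be its commutator subgroup and $SG_n''$ the commutator subgroup of $SG_n'$. Then: (i) For every $n\ge 5$, $SG_n'$ is finitely generated, and its rank (the minimal number of generators) is at most $2n-4$. (ii) $SG_3'$ and $SG_4'$ are not finitely generated. Moreover, $SG_3'/SG_3''$ is isomorphic to the free abelian group of countably infinite rank $\bigoplus_{i=1}^{\infty}\mathbb Z$. (iii) For $n\ge 3$, $SG_n'$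 is perfect (equal to its own commutator subgroup) if and only if $n\ge 5$. -/

import Mathlib

/-- The `2(n-1)` generators `σ_i`, `ρ_i` of the singular braid group on `n` strands.
The index set `{1, …, n-1}` is `Fin (n - 1)`, shifted by one. -/
inductive SingularBraidGen (n : ℕ) : Type
  | sigma (i : Fin (n - 1)) : SingularBraidGen n
  | rho (i : Fin (n - 1)) : SingularBraidGen n

namespace SingularBraid

/-- `σ_i` as an element of the free group on the generators. -/
def s {n : ℕ} (i : Fin (n - 1)) : FreeGroup (SingularBraidGen n) :=
  FreeGroup.of (SingularBraidGen.sigma i)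

/-- `ρ_i` as an element of the free group on the generators. -/
def r {n : ℕ} (i : Fin (n - 1)) : FreeGroup (SingularBraidGen n) :=
  FreeGroup.of (SingularBraidGen.rho i)

/-- `|i - j| > 1`. -/
def Far {n : ℕ} (i j : Fin (n - 1)) : Prop :=
  (i : ℕ) + 1 < j ∨ (j : ℕ) + 1 < i

/-- The defining relators of the singular braid group; a relation `u = v` is encoded as the
relator `u * v⁻¹`. The hypothesis `(j : ℕ) = i + 1` says that `j` is the index `i + 1`. -/
inductive Relator (n : ℕ) : FreeGroup (SingularBraidGen n) → Prop
  | sigma_comm (i j : Fin (n - 1)) (h : Far i j) :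
      Relator n ((s i * s j) * (s j * s i)⁻¹)
  | sigma_braid (i j : Fin (n - 1)) (h : (j : ℕ) = i + 1) :
      Relator n ((s i * s j * s i) * (s j * s i * s j)⁻¹)
  | rho_comm (i j : Fin (n - 1)) (h : Far i j) :
      Relator n ((r i * r j) * (r j * r i)⁻¹)
  | mixed_left (i j : Fin (n - 1)) (h : (j : ℕ) = i + 1) :
      Relator n ((r i * s j * s i) * (s j * s i * r j)⁻¹)
  | mixed_right (i j : Fin (n - 1)) (h : (j : ℕ) = i + 1) :
      Relator n ((r j * s i * s j) * (s i * s j * r i)⁻¹)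
  | sigma_rho_comm (i j : Fin (n - 1)) (h : i = j ∨ Far i j) :
      Relator n ((s i * r j) * (r j * s i)⁻¹)

end SingularBraid

/-- The singular braid group `SG_n` on `n` strands. -/
abbrev SingularBraidGroup (n : ℕ) : Type :=
  PresentedGroup {w : FreeGroup (SingularBraidGen n) | SingularBraid.Relator n w}

/-!
Let `n ≥ 5`. Since `σ_4` and `ρ_4` commute with `σ_1`, `σ_2`, `ρ_1` and `ρ_2`, the subgroup
generated by the `2n - 4` elements `σ_i σ_1⁻¹` and `ρ_i ρ_1⁻¹` is normalized by `σ_1` and `ρ_1`,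
hence equal to `SG_n'`. Modulo `SG_n''` the letter `σ_1` commutes with `σ_2`, again by means of
`σ_4`, and the braid relations then give `σ_1 = σ_2` and `ρ_1 = ρ_2`. As `σ_1` commutes with `σ_3,
σ_4, …`, all `σ_i` and all `ρ_i` become equal one after the other, so `SG_n' = SG_n''`.

For `n = 3`, let `ω ^ 2 = ω - 1`. Homotheties of ratio `ω` satisfy the braid relation whatever their
centres are, so `SG_3` acts on `ℤ[ω][t, t⁻¹]` with `σ_i` and `ρ_i` acting as the homotheties of
ratios `ω` and `t` about a common centre, depending on `i`. Then `SG_3'` acts by translations, and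
the conjugates of `σ_2 σ_1⁻¹` by `σ_1 ^ m ρ_1 ^ k`, for `m ∈ {0, 1}` and `k ∈ ℤ`, generate `SG_3'`
and translate by the elements `ω ^ m t ^ k`, a basis over `ℤ`.

Finally `SG_4` maps onto `SG_3` by sending the indices `1, 2, 3` to `1, 2, 1`.
-/

section GroupTheory

variable {G : Type*} [Group G]

theorem eq_of_semiconjBy_of_commute {g x y : G} (h : SemiconjBy g x y) (hc : Commute g x) :
    x = y :=
  mul_right_cancel (hc.eq.symm.trans h.eq)

theorem commute_of_commute_mul_inv {w x y : G} (hx : Commute w x) (hy : Commute w y)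
    (h : Commute (x * w⁻¹) (x * y⁻¹)) : Commute x y := by
  have hxy : Commute x (x * y⁻¹) := by
    simpa using h.mul_left (hx.mul_right hy.inv_right)
  simpa using ((Commute.refl x).inv_right.mul_right hxy).inv_right

theorem mul_inv_mem_commutator_of_isConj {a b : G} (h : IsConj a b) :
    b * a⁻¹ ∈ commutator G := by
  obtain ⟨c, rfl⟩ := isConj_iff.1 h
  exact Subgroup.commutator_mem_commutator (Subgroup.mem_top c) (Subgroup.mem_top a)

theorem commutator_le_of_mem_normalizer {H : Subgroup G} {a b : G} (hab : Commute a b)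
    (ha : a ∈ Subgroup.normalizer (H : Set G)) (hb : b ∈ Subgroup.normalizer (H : Set G))
    (htop : H ⊔ Subgroup.closure {a, b} = ⊤) : commutator G ≤ H := by
  have hH : H.Normal := by
    rw [← Subgroup.normalizer_eq_top_iff, eq_top_iff, ← htop, sup_le_iff, Subgroup.closure_le]
    refine ⟨Subgroup.le_normalizer, ?_⟩
    rintro x (rfl | rfl) <;> assumption
  refine Subgroup.Normal.commutator_le_of_self_sup_commutative_eq_top htop
    (Subgroup.isMulCommutative_closure ?_)
  rintro x (rfl | rfl) y (rfl | rfl)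
  exacts [rfl, hab.eq, hab.eq.symm, rfl]

theorem mem_normalizer_closure_of_zpow_conj_mem {S : Set G} {b : G}
    (h : ∀ x ∈ S, ∀ m : ℤ, b ^ m * x * (b ^ m)⁻¹ ∈ Subgroup.closure S) :
    b ∈ Subgroup.normalizer (Subgroup.closure S : Set G) := by
  suffices Subgroup.zpowers b ≤ Subgroup.normalizer (Subgroup.closure S : Set G) from
    this (Subgroup.mem_zpowers b)
  rw [Subgroup.le_normalizer_closure_iff]
  rintro _ ⟨m, rfl⟩ x hx
  exact h x hx m

/-- Conjugation by `b` acts on `x` as conjugation by `(d * b⁻¹)⁻¹`, an element of the closure. -/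
theorem mem_normalizer_closure_of_commute {S : Set G} {b : G}
    (h : ∀ x ∈ S, ∃ d, Commute b d ∧ Commute d x ∧ d * b⁻¹ ∈ Subgroup.closure S) :
    b ∈ Subgroup.normalizer (Subgroup.closure S : Set G) := by
  refine mem_normalizer_closure_of_zpow_conj_mem fun x hx m => ?_
  obtain ⟨d, hbd, hdx, hd⟩ := h x hx
  have hconj : b ^ m * x * (b ^ m)⁻¹ = ((d * b⁻¹) ^ m)⁻¹ * x * (d * b⁻¹) ^ m := by
    have hdm : (d ^ m)⁻¹ * x * d ^ m = x := by
      rw [mul_assoc, ← (hdx.zpow_left m).eq, inv_mul_cancel_left]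
    have hbdm : (d * b⁻¹) ^ m = d ^ m * (b ^ m)⁻¹ := by
      rw [hbd.symm.inv_right.mul_zpow, inv_zpow]
    calc b ^ m * x * (b ^ m)⁻¹ = b ^ m * ((d ^ m)⁻¹ * x * d ^ m) * (b ^ m)⁻¹ := by rw [hdm]
      _ = _ := by rw [hbdm]; group
  rw [hconj]
  exact mul_mem (mul_mem (inv_mem (zpow_mem hd m)) (Subgroup.subset_closure hx)) (zpow_mem hd m)

section Surjective

variable {H : Type*} [Group H] {f : G →* H}

theorem map_commutator_of_surjective (hf : Function.Surjective f) :
    (commutator G).map f = commutator H := by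
  rw [map_commutator_eq, MonoidHom.range_eq_top.2 hf, commutator_def]

theorem fg_commutator_of_surjective (hf : Function.Surjective f) [Group.FG (commutator G)] :
    Group.FG (commutator H) := by
  rw [← map_commutator_of_surjective hf]
  exact Group.fg_of_surjective (f.subgroupMap_surjective _)

theorem isPerfect_commutator_of_surjective (hf : Function.Surjective f)
    [Group.IsPerfect (commutator G)] : Group.IsPerfect (commutator H) := by
  rw [← map_commutator_of_surjective hf]
  exact Group.IsPerfect.map f

end Surjective

theorem bijective_abelianizationLift_of_basis {A ι : Type*} [AddCommGroup A]
    (φ : G →* Multiplicative A) (b : Module.Basis ι ℤ A) {g : ι → G}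
    (hg : Subgroup.closure (Set.range g) = ⊤) (hφ : ∀ i, φ (g i) = .ofAdd (b i)) :
    Function.Bijective (Abelianization.lift φ) := by
  let ψ : Multiplicative A →* Abelianization G := AddMonoidHom.toMultiplicativeLeft
    (b.constr ℤ fun i => Additive.ofMul (Abelianization.of (g i))).toAddMonoidHom
  have hψ : ∀ i, ψ (.ofAdd (b i)) = Abelianization.of (g i) := fun i =>
    congrArg Additive.toMul (b.constr_basis ℤ _ i)
  have hleft : ψ.comp φ = Abelianization.of :=
    MonoidHom.eq_of_eqOn_dense hg (by rintro _ ⟨i, rfl⟩; simp [hφ, hψ])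
  constructor
  · refine Function.LeftInverse.injective (g := ψ) fun x => ?_
    obtain ⟨x, rfl⟩ := QuotientGroup.mk_surjective x
    exact DFunLike.congr_fun hleft x
  · have hright :
        (AddMonoidHom.toMultiplicative.symm ((Abelianization.lift φ).comp ψ)).toIntLinearMap =
          LinearMap.id :=
      b.ext fun i => by
        change (Abelianization.lift φ (ψ (.ofAdd (b i)))).toAdd = b i
        rw [hψ, Abelianization.lift_apply_of, hφ, toAdd_ofAdd]
    exact fun y => ⟨ψ y, LinearMap.congr_fun hright y.toAdd⟩

theorem not_fg_multiplicative_finsupp (ι : Type*) [Infinite ι] :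
    ¬ Group.FG (Multiplicative (ι →₀ ℤ)) := by
  intro h
  have : Module.Finite ℤ (ι →₀ ℤ) :=
    Module.Finite.iff_addGroup_fg.2 (AddGroup.fg_iff_mul_fg.2 h)
  have := Module.Finite.finite_basis (Finsupp.basisSingleOne (R := ℤ) (ι := ι))
  exact not_finite ι

end GroupTheory

section BraidConjugates

variable {G : Type*} [Group G] {a b c : G}

/-- The conjugate of `b * a⁻¹` by `a ^ m * c ^ k`. In a group generated by `a`, `b`, `c`, where `a`
and `b` satisfy the braid relation and `a` and `c` commute, these elements generate the commutator
subgroup. -/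
def braidConj (a b c : G) (m k : ℤ) : G :=
  a ^ m * c ^ k * (b * a⁻¹) * (a ^ m * c ^ k)⁻¹

theorem zpow_mul_braidConj_mul_inv (l m k : ℤ) :
    a ^ l * braidConj a b c m k * (a ^ l)⁻¹ = braidConj a b c (l + m) k := by
  rw [braidConj, braidConj, zpow_add]
  group

theorem zpow_mul_braidConj_mul_inv_of_commute (hac : Commute a c) (l m k : ℤ) :
    c ^ l * braidConj a b c m k * (c ^ l)⁻¹ = braidConj a b c m (l + k) := by
  have h : a ^ m * c ^ (l + k) = c ^ l * (a ^ m * c ^ k) := by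
    rw [zpow_add, ← mul_assoc, (hac.zpow_zpow m l).eq, mul_assoc]
  rw [braidConj, braidConj, h]
  group

/-- The characteristic polynomial of this recurrence is `X ^ 2 - X + 1`. -/
theorem braidConj_add_two (hab : a * b * a = b * a * b) (hac : Commute a c) (m k : ℤ) :
    braidConj a b c (m + 2) k = (braidConj a b c m k)⁻¹ * braidConj a b c (m + 1) k := by
  have hbase : a * a * (b * a⁻¹) * (a * a)⁻¹ =
      (b * a⁻¹)⁻¹ * (a * (b * a⁻¹) * a⁻¹) := by
    have hconj : a * b * a⁻¹ = b⁻¹ * (a * b) := by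
      rw [mul_inv_eq_iff_eq_mul, mul_assoc b⁻¹, hab, mul_assoc, inv_mul_cancel_left]
    calc a * a * (b * a⁻¹) * (a * a)⁻¹ = a * (a * b * a⁻¹) * a⁻¹ * a⁻¹ := by
          simp only [mul_assoc, mul_inv_rev]
      _ = (b * a⁻¹)⁻¹ * (a * (b * a⁻¹) * a⁻¹) := by rw [hconj]; group
  have hshift (l : ℤ) : braidConj a b c (m + l) k =
      a ^ m * c ^ k * (a ^ l * (b * a⁻¹) * (a ^ l)⁻¹) * (a ^ m * c ^ k)⁻¹ := by
    rw [braidConj, zpow_add, mul_assoc (a ^ m), (hac.zpow_zpow l k).eq]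
    group
  rw [hshift, hshift, zpow_two, hbase, braidConj, zpow_one]
  group

theorem braidConj_mem_closure (hab : a * b * a = b * a * b) (hac : Commute a c) (m k : ℤ) :
    braidConj a b c m k ∈
      Subgroup.closure (Set.range fun p : Fin 2 × ℤ => braidConj a b c (p.1 : ℕ) p.2) := by
  set H := Subgroup.closure (Set.range fun p : Fin 2 × ℤ => braidConj a b c (p.1 : ℕ) p.2)
  suffices braidConj a b c m k ∈ H ∧ braidConj a b c (m + 1) k ∈ H from this.1
  induction m with
  | zero => exact ⟨Subgroup.subset_closure ⟨(0, k), rfl⟩, Subgroup.subset_closure ⟨(1, k), rfl⟩⟩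
  | succ m ih =>
    refine ⟨ih.2, ?_⟩
    rw [add_assoc, one_add_one_eq_two, braidConj_add_two hab hac]
    exact mul_mem (inv_mem ih.1) ih.2
  | pred m ih =>
    rw [sub_add_cancel]
    refine ⟨?_, ih.1⟩
    have h := braidConj_add_two hab hac (-m - 1) k
    rw [show (-m - 1 + 2 : ℤ) = -m + 1 by ring, sub_add_cancel] at h
    rw [← H.inv_mem_iff, eq_mul_inv_of_mul_eq h.symm]
    exact mul_mem ih.2 (inv_mem ih.1)

theorem isConj_of_braid (hab : a * b * a = b * a * b) : IsConj a b :=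
  isConj_iff.2 ⟨a * b, by rw [mul_inv_eq_iff_eq_mul, hab, mul_assoc]⟩

theorem closure_range_braidConj (hab : a * b * a = b * a * b) (hac : Commute a c)
    (htop : Subgroup.closure {a, b, c} = ⊤) :
    Subgroup.closure (Set.range fun p : Fin 2 × ℤ => braidConj a b c (p.1 : ℕ) p.2) =
      commutator G := by
  set S := Set.range fun p : Fin 2 × ℤ => braidConj a b c (p.1 : ℕ) p.2
  have hmem : ∀ m k, braidConj a b c m k ∈ Subgroup.closure S := braidConj_mem_closure hab hac
  refine le_antisymm ?_ (commutator_le_of_mem_normalizer hac ?_ ?_ ?_)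
  · rw [Subgroup.closure_le]
    rintro _ ⟨p, rfl⟩
    have hN : (commutator G).Normal := inferInstance
    exact hN.conj_mem _
      (mul_inv_mem_commutator_of_isConj (isConj_of_braid hab)) _
  · refine mem_normalizer_closure_of_zpow_conj_mem ?_
    rintro _ ⟨p, rfl⟩ l
    simp only [zpow_mul_braidConj_mul_inv, hmem]
  · refine mem_normalizer_closure_of_zpow_conj_mem ?_
    rintro _ ⟨p, rfl⟩ l
    simp only [zpow_mul_braidConj_mul_inv_of_commute hac, hmem]
  · have ha : a ∈ Subgroup.closure S ⊔ Subgroup.closure {a, c} :=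
      Subgroup.mem_sup_right (Subgroup.subset_closure (by simp))
    have hba : b * a⁻¹ ∈ Subgroup.closure S ⊔ Subgroup.closure {a, c} :=
      Subgroup.mem_sup_left (by simpa [braidConj] using hmem 0 0)
    rw [eq_top_iff, ← htop, Subgroup.closure_le]
    rintro x (rfl | rfl | rfl)
    exacts [ha, by simpa using mul_mem hba ha,
      Subgroup.mem_sup_right (Subgroup.subset_closure (by simp))]

end BraidConjugates

section AffineAction

theorem semiconjBy_homothetyUnitsMulHom {R V P : Type*} [CommRing R] [AddCommGroup V] [Module R V]
    [AddTorsor V P] (e : P ≃ᵃ[R] P) (p : P) (u : Rˣ) :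
    SemiconjBy e (AffineEquiv.homothetyUnitsMulHom p u)
      (AffineEquiv.homothetyUnitsMulHom (e p) u) := by
  ext x
  simp [AffineMap.homothety_eq_lineMap, AffineEquiv.apply_lineMap]

/-- This is why homotheties of ratio `w` satisfy the braid relation, wherever their centres are. -/
theorem homothety_homothety_apply {R V P : Type*} [CommRing R] [AddCommGroup V] [Module R V]
    [AddTorsor V P] {w : R} (hw : w * w = w - 1) (x y : P) :
    AffineMap.homothety x w (AffineMap.homothety y w x) = y := by
  rw [AffineMap.homothety_apply y, AffineMap.homothety_apply x, vadd_vsub_assoc,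
    ← neg_vsub_eq_vsub_rev x y, ← sub_eq_add_neg, smul_sub, smul_smul, hw, sub_smul, one_smul,
    sub_sub_cancel_left, neg_vsub_eq_vsub_rev, vsub_vadd]

variable {G R : Type*} [Group G] [CommRing R]

/-- The second centre is `w` so that the middle factor translates by `w - w * w = 1`. -/
theorem braidConj_homothety_apply_zero {w : Rˣ} (hw : (w * w : R) = w - 1) (t : Rˣ) (m k : ℤ) :
    braidConj (AffineEquiv.homothetyUnitsMulHom (0 : R) w)
      (AffineEquiv.homothetyUnitsMulHom (w : R) w) (AffineEquiv.homothetyUnitsMulHom 0 t) m k 0 =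
      (w ^ m * t ^ k : Rˣ) := by
  rw [braidConj, ← map_zpow, ← map_zpow, ← map_mul, ← map_inv, ← map_inv]
  generalize w ^ m * t ^ k = u
  simp only [AffineEquiv.mul_def, AffineEquiv.trans_apply,
    AffineEquiv.coe_homothetyUnitsMulHom_apply, AffineMap.homothety_apply_same]
  simp only [AffineMap.homothety_apply, vsub_eq_sub, vadd_eq_add, smul_eq_mul]
  linear_combination (-u : R) * hw

theorem apply_eq_add_of_mem_commutator (f : G →* R ≃ᵃ[R] R) {x : G} (hx : x ∈ commutator G)
    (y : R) : f x y = y + f x 0 := by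
  have hle : commutator G ≤ (AffineEquiv.linearHom.comp f).ker := by
    rw [commutator_def, Subgroup.commutator_le]
    intro g _ h _
    rw [MonoidHom.mem_ker, map_commutatorElement, commutatorElement_eq_one_iff_mul_comm]
    refine LinearEquiv.toLinearMap_injective (LinearMap.ext_ring ?_)
    have happly (A B : R ≃ₗ[R] R) : A (B 1) = B 1 * A 1 := by
      simpa only [smul_eq_mul, mul_one] using A.map_smul (B 1) 1
    exact (happly _ _).trans ((mul_comm _ _).trans (happly _ _).symm)
  have hlin : (f x).linear = 1 := hle hx
  simpa [hlin] using (f x).map_vadd 0 y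

/-- The homomorphism which gives the translation parts of the elements of the commutator subgroup of
a group acting on a commutative ring by affine maps. It is used to compute `SG_3' / SG_3''`. -/
def translationHom (f : G →* R ≃ᵃ[R] R) : commutator G →* Multiplicative R where
  toFun x := .ofAdd (f x 0)
  map_one' := by simp
  map_mul' x y := by
    rw [Subgroup.coe_mul, map_mul, AffineEquiv.mul_def, AffineEquiv.trans_apply,
      apply_eq_add_of_mem_commutator f x.2, add_comm, ofAdd_add]

end AffineAction

section EisensteinLaurent

open LaurentPolynomial

theorem quadraticAlgebra_basis_apply {R : Type*} [CommSemiring R] (a b : R) (i : Fin 2) :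
    QuadraticAlgebra.basis a b i = QuadraticAlgebra.omega ^ (i : ℕ) := by
  apply (QuadraticAlgebra.basis a b).repr.injective
  ext j
  fin_cases i <;> fin_cases j <;>
    simp [QuadraticAlgebra.basis_repr_apply, QuadraticAlgebra.re_one, QuadraticAlgebra.im_one]

/-- The ring `ℤ[ω][T, T⁻¹]` of Laurent polynomials over the Eisenstein integers, where
`ω ^ 2 = ω - 1`. -/
abbrev EisensteinLaurent := (QuadraticAlgebra ℤ (-1) 1)[T;T⁻¹]

theorem EisensteinLaurent.exists_units_basis :
    ∃ (w t : EisensteinLaurentˣ) (b : Module.Basis (Fin 2 × ℤ) ℤ EisensteinLaurent),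
      (w * w : EisensteinLaurent) = w - 1 ∧
        ∀ p, b p = (w ^ ((p.1 : ℕ) : ℤ) * t ^ p.2 : EisensteinLaurentˣ) := by
  let ω : QuadraticAlgebra ℤ (-1) 1 := QuadraticAlgebra.omega
  have hω : ω * ω = ω - 1 := by
    ext <;> simp [ω, QuadraticAlgebra.re_one, QuadraticAlgebra.im_one]
  let u : (QuadraticAlgebra ℤ (-1) 1)ˣ := Units.mkOfMulEqOne ω (1 - ω) (by
    rw [mul_sub, hω, mul_one, sub_sub_cancel])
  let T : Multiplicative ℤ →* EisensteinLaurentˣ :=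
    (Units.map (AddMonoidAlgebra.of _ ℤ)).comp toUnits.toMonoidHom
  have hT (k : ℤ) : ((T (.ofAdd 1) ^ k : EisensteinLaurentˣ) : EisensteinLaurent) =
      .single k 1 := by
    rw [← map_zpow, ← ofAdd_zsmul, smul_eq_mul, mul_one]
    rfl
  refine ⟨Units.map C.toMonoidHom u, T (.ofAdd 1), (QuadraticAlgebra.basis (-1) 1).smulTower
    (AddMonoidAlgebra.basis ℤ _), ?_, fun p => ?_⟩
  · change C ω * C ω = C ω - 1
    rw [← map_mul, hω, map_sub, map_one]
  · rw [Module.Basis.smulTower_apply, AddMonoidAlgebra.basis_apply, quadraticAlgebra_basis_apply,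
      smul_eq_C_mul, map_pow, Units.val_mul, hT, zpow_natCast, Units.val_pow_eq_pow_val]
    rfl

end EisensteinLaurent

namespace SingularBraid

variable {n : ℕ} {G H : Type*} [Group G] [Group H]

/-- `|i - j| = 1`, the condition complementary to `i = j ∨ Far i j`. -/
def Adjacent (i j : Fin (n - 1)) : Prop :=
  (j : ℕ) = i + 1 ∨ (i : ℕ) = j + 1

theorem index_induction [NeZero (n - 1)] {P : Fin (n - 1) → Prop} (zero : P 0)
    (succ : ∀ i j : Fin (n - 1), (j : ℕ) = i + 1 → P i → P j) (i : Fin (n - 1)) : P i := by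
  obtain ⟨i, hi⟩ := i
  induction i with
  | zero => exact zero
  | succ k ih => exact succ ⟨k, by omega⟩ _ rfl (ih _)

/-- The generators of `SG_n`, as two families indexed by a letter: `gen false i` is `σ_i` and
`gen true i` is `ρ_i`. -/
def gen : Bool → Fin (n - 1) → SingularBraidGroup n
  | false, i => PresentedGroup.of (.sigma i)
  | true, i => PresentedGroup.of (.rho i)

/-- The defining relations of `SG_n` for a pair of families `c false`, `c true` of elements of a
group, in the places of the `σ_i` and the `ρ_i`. All relations which are not commutations say that
`σ_i σ_j` with `|i - j| = 1` conjugates a letter of index `i` to the same letter of index `j`. -/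
structure SatisfiesRelations (c : Bool → Fin (n - 1) → G) : Prop where
  commute : ∀ ε δ i j, i = j ∨ Far i j → Commute (c ε i) (c δ j)
  semiconjBy : ∀ ε i j, Adjacent i j → SemiconjBy (c false i * c false j) (c ε i) (c ε j)

theorem satisfiesRelations_gen : SatisfiesRelations (gen (n := n)) where
  commute ε δ i j h := by
    have hsr {i j : Fin (n - 1)} (h : i = j ∨ Far i j) : Commute (gen false i) (gen true j) :=
      PresentedGroup.mk_eq_mk_of_mul_inv_mem (.sigma_rho_comm i j h)
    cases ε <;> cases δ
    · rcases h with rfl | h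
      exacts [.refl _, PresentedGroup.mk_eq_mk_of_mul_inv_mem (.sigma_comm i j h)]
    · exact hsr h
    · exact (hsr (h.imp Eq.symm Or.symm)).symm
    · rcases h with rfl | h
      exacts [.refl _, PresentedGroup.mk_eq_mk_of_mul_inv_mem (.rho_comm i j h)]
  semiconjBy ε i j h := by
    rw [SemiconjBy, ← mul_assoc]
    cases ε <;> rcases h with h | h
    · exact PresentedGroup.mk_eq_mk_of_mul_inv_mem (.sigma_braid i j h)
    · exact (PresentedGroup.mk_eq_mk_of_mul_inv_mem (.sigma_braid j i h)).symm
    · exact (PresentedGroup.mk_eq_mk_of_mul_inv_mem (.mixed_right i j h)).symm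
    · exact (PresentedGroup.mk_eq_mk_of_mul_inv_mem (.mixed_left j i h)).symm

theorem eq_top_of_gen_mem {H : Subgroup (SingularBraidGroup n)} (h : ∀ ε i, gen ε i ∈ H) :
    H = ⊤ := by
  rw [eq_top_iff, ← PresentedGroup.closure_range_of, Subgroup.closure_le]
  rintro _ ⟨i | i, rfl⟩
  exacts [h false i, h true i]

namespace SatisfiesRelations

variable {c : Bool → Fin (n - 1) → G}

theorem map (hc : SatisfiesRelations c) (f : G →* H) :
    SatisfiesRelations fun ε i => f (c ε i) where
  commute ε δ i j h := (hc.commute ε δ i j h).map f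
  semiconjBy ε i j h := by simpa only [map_mul] using (hc.semiconjBy ε i j h).map f

/-- The homomorphism from `SG_n` which sends `σ_i` to `c false i` and `ρ_i` to `c true i`. -/
def lift (hc : SatisfiesRelations c) : SingularBraidGroup n →* G :=
  PresentedGroup.toGroup
    (f := fun | .sigma i => c false i | .rho i => c true i) (by
      have hadj {ε i j} (h : Adjacent i j) :
          c false i * c false j * c ε i = c ε j * c false i * c false j := by
        rw [mul_assoc (c ε j), (hc.semiconjBy ε i j h).eq]
      rintro _ (⟨i, j, h⟩ | ⟨i, j, h⟩ | ⟨i, j, h⟩ | ⟨i, j, h⟩ | ⟨i, j, h⟩ | ⟨i, j, h⟩) <;>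
        rw [map_mul, map_inv, mul_inv_eq_one] <;>
        simp only [s, r, map_mul, FreeGroup.lift_apply_of]
      exacts [hc.commute false false i j (.inr h), hadj (.inl h), hc.commute true true i j (.inr h),
        (hadj (.inr h)).symm, (hadj (.inl h)).symm, hc.commute false true i j h])

@[simp]
theorem lift_gen (hc : SatisfiesRelations c) (ε : Bool) (i : Fin (n - 1)) :
    hc.lift (gen ε i) = c ε i := by
  cases ε <;> exact PresentedGroup.toGroup.of _

theorem isConj_of_adjacent (hc : SatisfiesRelations c) (ε : Bool) {i j : Fin (n - 1)}
    (h : Adjacent i j) : IsConj (c ε i) (c ε j) :=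
  isConj_iff.2 ⟨_, mul_inv_eq_iff_eq_mul.2 (hc.semiconjBy ε i j h).eq⟩

theorem isConj [NeZero (n - 1)] (hc : SatisfiesRelations c) (ε : Bool) (i : Fin (n - 1)) :
    IsConj (c ε 0) (c ε i) := by
  induction i using index_induction with
  | zero => exact .refl _
  | succ i j hij h => exact h.trans (hc.isConj_of_adjacent ε (.inl hij))

theorem eq_of_commute (hc : SatisfiesRelations c) {i j : Fin (n - 1)} (hij : Adjacent i j)
    (h : Commute (c false i) (c false j)) (ε : Bool) : c ε i = c ε j := by
  have hσ : c false i = c false j :=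
    eq_of_semiconjBy_of_commute (hc.semiconjBy false i j hij) ((Commute.refl _).mul_left h.symm)
  have hi : Commute (c false i) (c ε i) := hc.commute false ε i i (.inl rfl)
  exact eq_of_semiconjBy_of_commute (hc.semiconjBy ε i j hij) (hi.mul_left (hσ ▸ hi))

theorem eq_apply_zero_of_commute_mul_inv [NeZero (n - 1)] (hn : 5 ≤ n) (hc : SatisfiesRelations c)
    (h : ∀ i j, Commute (c false i * (c false 0)⁻¹) (c false j * (c false 0)⁻¹))
    (ε : Bool) (i : Fin (n - 1)) : c ε i = c ε 0 := by
  have hzero_one {j : Fin (n - 1)} (hj : (j : ℕ) = 1) : Commute (c false 0) (c false j) := by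
    let k : Fin (n - 1) := ⟨3, by omega⟩
    have hk0 : Commute (c false k) (c false 0) :=
      hc.commute false false k 0 (.inr (.inr (by simp [k])))
    have hkj : Commute (c false k) (c false j) :=
      hc.commute false false k j (.inr (.inr (by simp [k, hj])))
    exact commute_of_commute_mul_inv hk0 hkj (by simpa using (h k j).inv_inv)
  induction i using index_induction generalizing ε with
  | zero => rfl
  | succ i j hij ih =>
    suffices Commute (c false i) (c false j) from
      (hc.eq_of_commute (.inl hij) this ε).symm.trans (ih ε)
    rw [ih false]
    by_cases hi : (i : ℕ) = 0
    · exact hzero_one (by omega)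
    · exact hc.commute false false 0 j (.inr (.inl (by rw [Fin.val_zero]; omega)))

end SatisfiesRelations

theorem gen_mul_inv_mem_commutator [NeZero (n - 1)] (ε : Bool) (i : Fin (n - 1)) :
    gen ε i * (gen ε 0)⁻¹ ∈ commutator (SingularBraidGroup n) :=
  mul_inv_mem_commutator_of_isConj (satisfiesRelations_gen.isConj ε i)

theorem commutator_le_of_gen_mul_inv_mem [NeZero (n - 1)] {H : Subgroup (SingularBraidGroup n)}
    (hH : ∀ ε, gen ε 0 ∈ Subgroup.normalizer (H : Set (SingularBraidGroup n)))
    (h : ∀ ε i, gen ε i * (gen ε 0)⁻¹ ∈ H) : commutator (SingularBraidGroup n) ≤ H := by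
  refine commutator_le_of_mem_normalizer
    (satisfiesRelations_gen.commute false true 0 0 (.inl rfl)) (hH false) (hH true)
    (eq_top_of_gen_mem fun ε i => ?_)
  rw [← inv_mul_cancel_right (gen ε i) (gen ε 0)]
  exact Subgroup.mul_mem_sup (h ε i) (Subgroup.subset_closure (by cases ε <;> simp))

theorem isPerfect_commutator (hn : 5 ≤ n) :
    Group.IsPerfect (commutator (SingularBraidGroup n)) := by
  have : NeZero (n - 1) := ⟨by omega⟩
  rw [Subgroup.isPerfect_iff]
  refine le_antisymm (Subgroup.commutator_le_self _) ?_
  set K := commutator (SingularBraidGroup n)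
  have hcomm {x y : SingularBraidGroup n} (hx : x ∈ K) (hy : y ∈ K) :
      Commute (QuotientGroup.mk' ⁅K, K⁆ x) (QuotientGroup.mk' ⁅K, K⁆ y) := by
    rw [← commutatorElement_eq_one_iff_commute, ← map_commutatorElement]
    exact (QuotientGroup.eq_one_iff _).2 (Subgroup.commutator_mem_commutator hx hy)
  have heq : ∀ ε i, QuotientGroup.mk' ⁅K, K⁆ (gen ε i) = QuotientGroup.mk' ⁅K, K⁆ (gen ε 0) :=
    (satisfiesRelations_gen.map _).eq_apply_zero_of_commute_mul_inv hn fun i j => by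
      simpa only [map_mul, map_inv] using
        hcomm (gen_mul_inv_mem_commutator false i) (gen_mul_inv_mem_commutator false j)
  refine commutator_le_of_gen_mul_inv_mem (fun ε => by simp [Subgroup.normalizer_eq_top])
    fun ε i => ?_
  rw [← QuotientGroup.eq_one_iff, ← QuotientGroup.mk'_apply, map_mul, map_inv, heq, mul_inv_cancel]

theorem closure_range_gen_mul_inv [NeZero (n - 1)] (hn : 5 ≤ n) :
    Subgroup.closure (Set.range fun p : Bool × {i : Fin (n - 1) // i ≠ 0} =>
      gen p.1 p.2.1 * (gen p.1 0)⁻¹) = commutator (SingularBraidGroup n) := by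
  set S := Set.range fun p : Bool × {i : Fin (n - 1) // i ≠ 0} => gen p.1 p.2.1 * (gen p.1 0)⁻¹
  have hmem (ε i) : gen ε i * (gen ε 0)⁻¹ ∈ Subgroup.closure S := by
    by_cases hi : i = 0
    · simp [hi]
    · exact Subgroup.subset_closure ⟨(ε, ⟨i, hi⟩), rfl⟩
  have hcomm {ε δ} {i j : Fin (n - 1)} (h : i = j ∨ Far i j) : Commute (gen ε i) (gen δ j) :=
    satisfiesRelations_gen.commute ε δ i j h
  refine le_antisymm ?_ (commutator_le_of_gen_mul_inv_mem (fun ε => ?_) hmem)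
  · rw [Subgroup.closure_le]
    rintro _ ⟨p, rfl⟩
    exact gen_mul_inv_mem_commutator _ _
  refine mem_normalizer_closure_of_commute ?_
  rintro _ ⟨⟨δ, i, hi⟩, rfl⟩
  have hi0 : (i : ℕ) ≠ 0 := fun h => hi (Fin.ext h)
  by_cases hi1 : (i : ℕ) = 1
  · let k : Fin (n - 1) := ⟨3, by omega⟩
    have hk0 : Far k 0 := .inr (by simp [k])
    have hki : Far k i := .inr (by simp [k, hi1])
    exact ⟨gen ε k, (hcomm (.inr hk0)).symm,
      (hcomm (.inr hki)).mul_right (hcomm (.inr hk0)).inv_right, hmem ε k⟩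
  · have h0i : Far 0 i := .inl (by rw [Fin.val_zero]; omega)
    exact ⟨gen ε 0, .refl _, (hcomm (.inr h0i)).mul_right (hcomm (.inl rfl)).inv_right, hmem ε 0⟩

theorem exists_fg_commutator_and_rank_le (hn : 5 ≤ n) :
    ∃ _ : Group.FG (commutator (SingularBraidGroup n)),
      Group.rank (commutator (SingularBraidGroup n)) ≤ 2 * n - 4 := by
  have : NeZero (n - 1) := ⟨by omega⟩
  have hcard : Nat.card (Bool × {i : Fin (n - 1) // i ≠ 0}) = 2 * n - 4 := by
    rw [Nat.card_eq_fintype_card, Fintype.card_prod, Fintype.card_bool,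
      Fintype.card_subtype_compl, Fintype.card_subtype_eq, Fintype.card_fin]
    omega
  rw [← closure_range_gen_mul_inv hn, ← hcard]
  exact ⟨inferInstance, (Subgroup.rank_closure_finite_le_nat_card _).trans
    (Finite.card_range_le _)⟩

section ThreeStrands

theorem satisfiesRelations_homothety {R V P : Type*} [CommRing R] [AddCommGroup V] [Module R V]
    [AddTorsor V P] (p : Fin (3 - 1) → P) (u : Bool → Rˣ)
    (hu : (u false * u false : R) = u false - 1) :
    SatisfiesRelations fun ε i => AffineEquiv.homothetyUnitsMulHom (p i) (u ε) where
  commute ε δ i j h := by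
    obtain rfl : i = j := by
      rcases h with h | h
      · exact h
      · simp only [Far] at h
        omega
    exact (Commute.all (u ε) (u δ)).map _
  semiconjBy ε i j _ := by
    have hj : (AffineEquiv.homothetyUnitsMulHom (p i) (u false) *
        AffineEquiv.homothetyUnitsMulHom (p j) (u false)) (p i) = p j :=
      homothety_homothety_apply hu _ _
    simpa only [hj] using semiconjBy_homothetyUnitsMulHom
      (AffineEquiv.homothetyUnitsMulHom (p i) (u false) *
        AffineEquiv.homothetyUnitsMulHom (p j) (u false)) (p i) (u ε)

/-- The element `σ_1 ^ m ρ_1 ^ k (σ_2 σ_1⁻¹) ρ_1 ^ (-k) σ_1 ^ (-m)` of `SG_3`, where `p = (m, k)`;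
these are generators of `SG_3'`, and a basis of its abelianization. -/
def commutatorGen (p : Fin 2 × ℤ) : SingularBraidGroup 3 :=
  braidConj (gen false 0) (gen false 1) (gen true 0) (p.1 : ℕ) p.2

theorem closure_range_commutatorGen :
    Subgroup.closure (Set.range commutatorGen) = commutator (SingularBraidGroup 3) := by
  have hrel := satisfiesRelations_gen (n := 3)
  have hadj : Adjacent (0 : Fin (3 - 1)) (1 : Fin (3 - 1)) := .inl rfl
  have hclosure : Subgroup.closure {gen false 0, gen false (1 : Fin (3 - 1)), gen true 0} = ⊤ := by
    set S : Set (SingularBraidGroup 3) := {gen false 0, gen false (1 : Fin (3 - 1)), gen true 0}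
    have hσ0 : gen false 0 ∈ Subgroup.closure S := Subgroup.subset_closure (.inl rfl)
    have hσ1 : gen false (1 : Fin (3 - 1)) ∈ Subgroup.closure S :=
      Subgroup.subset_closure (.inr (.inl rfl))
    have hρ0 : gen true 0 ∈ Subgroup.closure S := Subgroup.subset_closure (.inr (.inr rfl))
    have hρ1 : gen true (1 : Fin (3 - 1)) ∈ Subgroup.closure S := by
      rw [eq_mul_inv_of_mul_eq (hrel.semiconjBy true 0 1 hadj).eq.symm]
      exact mul_mem (mul_mem (mul_mem hσ0 hσ1) hρ0) (inv_mem (mul_mem hσ0 hσ1))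
    refine eq_top_of_gen_mem fun ε (i : Fin 2) => ?_
    fin_cases ε <;> fin_cases i <;> assumption
  refine closure_range_braidConj ?_ (hrel.commute false true 0 0 (.inl rfl)) hclosure
  rw [(hrel.semiconjBy false 0 1 hadj).eq, mul_assoc]

theorem exists_affine_representation {R : Type*} [CommRing R] {w : Rˣ}
    (hw : (w * w : R) = w - 1) (t : Rˣ) :
    ∃ f : SingularBraidGroup 3 →* R ≃ᵃ[R] R,
      ∀ p, f (commutatorGen p) 0 = (w ^ ((p.1 : ℕ) : ℤ) * t ^ p.2 : Rˣ) := by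
  refine ⟨(satisfiesRelations_homothety (fun i => (i : ℕ) * (w : R)) (fun ε => cond ε t w) hw).lift,
    fun p => ?_⟩
  rw [← braidConj_homothety_apply_zero hw]
  simp only [commutatorGen, braidConj, map_mul, map_inv, map_zpow, SatisfiesRelations.lift_gen,
    Fin.val_zero, Fin.val_one, Nat.cast_zero, Nat.cast_one, zero_mul, one_mul, cond_true,
    cond_false]

theorem nonempty_abelianization_commutator_three_mulEquiv :
    Nonempty (Abelianization (commutator (SingularBraidGroup 3)) ≃* Multiplicative (ℕ →₀ ℤ)) := by
  obtain ⟨w, t, b, hw, hb⟩ := EisensteinLaurent.exists_units_basis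
  obtain ⟨f, hf⟩ := exists_affine_representation hw t
  have hmem (p : Fin 2 × ℤ) : commutatorGen p ∈ commutator (SingularBraidGroup 3) :=
    closure_range_commutatorGen ▸ Subgroup.subset_closure ⟨p, rfl⟩
  let g (p : Fin 2 × ℤ) : commutator (SingularBraidGroup 3) := ⟨commutatorGen p, hmem p⟩
  have hg : Subgroup.closure (Set.range g) = ⊤ := by
    apply Subgroup.map_injective (commutator (SingularBraidGroup 3)).subtype_injective
    rw [MonoidHom.map_closure, ← Set.range_comp, ← MonoidHom.range_eq_map, Subgroup.range_subtype]
    exact closure_range_commutatorGen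
  have hfg (p : Fin 2 × ℤ) : translationHom f (g p) = .ofAdd (b p) := by
    rw [hb, ← hf]
    rfl
  let e := MulEquiv.ofBijective _
    (bijective_abelianizationLift_of_basis (translationHom f) b hg hfg)
  obtain ⟨hι⟩ : Nonempty (Fin 2 × ℤ ≃ ℕ) := nonempty_equiv_of_countable
  let coordinates : EisensteinLaurent ≃+ (ℕ →₀ ℤ) :=
    b.repr.toAddEquiv.trans (Finsupp.domCongr hι)
  exact ⟨e.trans coordinates.toMultiplicative⟩

theorem not_fg_commutator_three : ¬ Group.FG (commutator (SingularBraidGroup 3)) := by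
  intro h
  obtain ⟨e⟩ := nonempty_abelianization_commutator_three_mulEquiv
  have : Group.FG (Abelianization (commutator (SingularBraidGroup 3))) :=
    Group.fg_of_surjective (f := Abelianization.of) QuotientGroup.mk_surjective
  exact not_fg_multiplicative_finsupp ℕ (Group.fg_of_surjective (f := e.toMonoidHom) e.surjective)

theorem not_isPerfect_commutator_three :
    ¬ Group.IsPerfect (commutator (SingularBraidGroup 3)) := by
  intro h
  obtain ⟨e⟩ := nonempty_abelianization_commutator_three_mulEquiv
  have : Subsingleton (Abelianization (commutator (SingularBraidGroup 3))) :=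
    QuotientGroup.subsingleton_iff.2 Group.IsPerfect.commutator_eq_top
  exact not_subsingleton (Multiplicative (ℕ →₀ ℤ)) e.symm.subsingleton

end ThreeStrands

section FourStrands

/-- The map of indices `1, 2, 3 ↦ 1, 2, 1` which induces `SG_4 → SG_3`, written for indices which
start from `0`. -/
def foldIndex (i : Fin (4 - 1)) : Fin (3 - 1) := ⟨i % 2, Nat.mod_lt _ two_pos⟩

theorem foldIndex_eq_of_far {i j : Fin (4 - 1)} (h : Far i j) : foldIndex i = foldIndex j := by
  simp only [Far] at h
  simp only [foldIndex, Fin.mk.injEq]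
  omega

theorem Adjacent.foldIndex {i j : Fin (4 - 1)} (h : Adjacent i j) :
    Adjacent (foldIndex i) (foldIndex j) := by
  simp only [Adjacent, SingularBraid.foldIndex] at *
  omega

theorem satisfiesRelations_gen_foldIndex :
    SatisfiesRelations (n := 4) fun ε i => gen ε (foldIndex i) where
  commute ε δ _ _ h :=
    satisfiesRelations_gen.commute ε δ _ _ (.inl (h.elim (congrArg _) foldIndex_eq_of_far))
  semiconjBy ε _ _ h := satisfiesRelations_gen.semiconjBy ε _ _ h.foldIndex

theorem exists_surjective_four_three :
    ∃ f : SingularBraidGroup 4 →* SingularBraidGroup 3, Function.Surjective f := by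
  refine ⟨satisfiesRelations_gen_foldIndex.lift,
    MonoidHom.range_eq_top.1 (eq_top_of_gen_mem fun ε i => ?_)⟩
  have hi : foldIndex ⟨i, by omega⟩ = i := Fin.ext (Nat.mod_eq_of_lt i.2)
  exact ⟨gen ε ⟨i, by omega⟩, by rw [SatisfiesRelations.lift_gen, hi]⟩

theorem not_fg_commutator_four : ¬ Group.FG (commutator (SingularBraidGroup 4)) := by
  intro h
  obtain ⟨f, hf⟩ := exists_surjective_four_three
  exact not_fg_commutator_three (fg_commutator_of_surjective hf)

theorem not_isPerfect_commutator_four :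
    ¬ Group.IsPerfect (commutator (SingularBraidGroup 4)) := by
  intro h
  obtain ⟨f, hf⟩ := exists_surjective_four_three
  exact not_isPerfect_commutator_three (isPerfect_commutator_of_surjective hf)

end FourStrands

end SingularBraid

open SingularBraid in
theorem theorem1p1 :
    (∀ n : ℕ, 5 ≤ n →
      ∃ _ : Group.FG (commutator (SingularBraidGroup n)),
        Group.rank (commutator (SingularBraidGroup n)) ≤ 2 * n - 4) ∧
    ¬ Group.FG (commutator (SingularBraidGroup 3)) ∧
    ¬ Group.FG (commutator (SingularBraidGroup 4)) ∧
    Nonempty (Abelianization (commutator (SingularBraidGroup 3)) ≃* Multiplicative (ℕ →₀ ℤ)) ∧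
    (∀ n : ℕ, 3 ≤ n →
      (Group.IsPerfect (commutator (SingularBraidGroup n)) ↔ 5 ≤ n)) := by
  refine ⟨fun n hn => exists_fg_commutator_and_rank_le hn, not_fg_commutator_three,
    not_fg_commutator_four, nonempty_abelianization_commutator_three_mulEquiv,
    fun n hn => ⟨fun h => ?_, isPerfect_commutator⟩⟩
  by_contra! h5
  obtain rfl | rfl : n = 3 ∨ n = 4 := by omega
  · exact not_isPerfect_commutator_three h
  · exact not_isPerfect_commutator_four h
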